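/- Let $\phi=(\phi_{i,j})_{i,j\ge 1}$ be real numbers with $\phi_{i,j}=\phi_{j,i}\ge 0$ such that, for all integers $i,j\ge1$, one of the following three bounds holds (the same one for all $i,j$): $$\phi_{i,j}\le \frac{i+j}{\min\{i,j\}},\qquad \phi_{i,j}\le i+j,\qquad \phi_{i,j}\le(1+i+j)^{\alpha}\ \text{ for some fixed }\alpha\in[0,1].$$ Assume moreover that $\phi_{i,j}\le ij$ for all $i,j\ge1$ and that $\lim_{n\to\infty}\phi_{n,j}=0$ for every fixed $j\ge1$. Let $B^+$ be the set of sequences $z=(z_i)_{i\ge1}$ with $z_i\ge0$ and $\|z\|:=\sum_{i\ge1} i|z_i|<\infty$, and let $c^0\in B^+$. For $T\in(0,\infty]$, a solution on $[0,T)$ of the Safronov-Dubovski equation with initial value $c^0$ is a function $c=(c_i):[0,T)\to B^+$ with $c(0)=c^0$ such that every $c_i$ is continuous, $\sup_{0\le t<T}\|c(t)\|<\infty$, and, for all $i\ge1$ and $0\le t<T$, $\int_0^t\sum_{j\ge1}\phi_{i,j}c_j(h)\,dh<\infty$ and $$c_i(t)=c_i(0)+\int_0^t\Bigl(\delta_{i\ge2}\,c_{i-1}(h)\sum_{j=1}^{i-1}j\phi_{i-1,j}c_j(h)-c_i(h)\sum_{j=1}^{i}j\phi_{i,j}c_j(h)-c_i(h)\sum_{j=i}^{\infty}\phi_{i,j}c_j(h)\Bigr)dh,$$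 where $\delta_{i\ge 2}$ is $1$ if $i\ge2$ and $0$ otherwise. For $n\ge2$, the truncated (non-conservative) system is the system of ordinary differential equations on $[0,\infty)$, for $c^n=(c^n_1,\dots,c^n_n)$ with $c^n_i(0)=c^0_i$, $$\frac{dc^n_1}{dt}=-\phi_{1,1}(c^n_1)^2-c^n_1\sum_{j=1}^n\phi_{1,j}c^n_j,\qquad \frac{dc^n_n}{dt}=c^n_{n-1}\sum_{j=1}^{n-1}j\phi_{n-1,j}c^n_j,$$ $$\frac{dc^n_i}{dt}=c^n_{i-1}\sum_{j=1}^{i-1}j\phi_{i-1,j}c^n_j-c^n_i\sum_{j=1}^{i}j\phi_{i,j}c^n_j-c^n_i\sum_{j=i}^n\phi_{i,j}c^n_j\qquad(2\le i\le n-1).$$ Then: 1. Every solution $c$ on $[0,T)$, $T\in(0,\infty]$, with initial value $c^0$ conserves density: for all $t\in[0,T)$, the series $\sum_i i\,c_i(t)$ converges and $$\sum_{i=1}^\infty i\,c_i(t)=\sum_{i=1}^\infty i\,c_i(0).$$ 2. The same identity holds for all $t\ge0$ for every function $c=(c_i)_{i\ge 1}$ on $[0,\infty)$ obtained from the truncated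 systems by passing to the limit, that is, such that $c_i(t)=\lim_{k\to\infty}c^{n_k}_i(t)$ for all $i\ge1$ and $t\ge0$, where $2\le n_1<n_2<\cdots$ and $c^{n_k}$ solves the truncated system of size $n_k$. -/

import Mathlib

open Set Filter Topology MeasureTheory

noncomputable section

namespace SafronovDubovski

/-! Sizes are the natural numbers `i ≥ 1`; values of kernels and sequences at the index `0` are
never used (in the sums `∑ i z_i` the term with `i = 0` vanishes because of the weight `i`). -/

/-- A coagulation kernel: nonnegative and symmetric. -/
structure IsKernel (φ : ℕ → ℕ → ℝ) : Prop where
  nonneg : ∀ i j : ℕ, 1 ≤ i → 1 ≤ j → 0 ≤ φ i j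
  symm : ∀ i j : ℕ, 1 ≤ i → 1 ≤ j → φ i j = φ j i

/-- The three classes of kernels under consideration. -/
def KernelClass (φ : ℕ → ℕ → ℝ) : Prop :=
  (∀ i j : ℕ, 1 ≤ i → 1 ≤ j → φ i j ≤ ((i : ℝ) + (j : ℝ)) / min (i : ℝ) (j : ℝ)) ∨
  (∀ i j : ℕ, 1 ≤ i → 1 ≤ j → φ i j ≤ (i : ℝ) + (j : ℝ)) ∨
  (∃ α : ℝ, 0 ≤ α ∧ α ≤ 1 ∧
    ∀ i j : ℕ, 1 ≤ i → 1 ≤ j → φ i j ≤ (1 + (i : ℝ) + (j : ℝ)) ^ α)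

/-- The norm `‖z‖ = ∑_{i ≥ 1} i |z_i|` of a sequence of finite mass. -/
def massNorm (z : ℕ → ℝ) : ℝ := ∑' i : ℕ, (i : ℝ) * |z i|

/-- Membership in the cone `B⁺` of nonnegative sequences of finite mass. -/
structure MemBPlus (z : ℕ → ℝ) : Prop where
  summable : Summable fun i : ℕ => (i : ℝ) * |z i|
  nonneg : ∀ i : ℕ, 1 ≤ i → 0 ≤ z i

/-- The right-hand side of the Safronov-Dubovski equation for the size `i` at the state `z`. The
third sum runs over all `j = i + k ≥ i`. -/
def rhs (φ : ℕ → ℕ → ℝ) (i : ℕ) (z : ℕ → ℝ) : ℝ :=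
  (if 2 ≤ i then z (i - 1) * ∑ j ∈ Finset.Icc 1 (i - 1), (j : ℝ) * φ (i - 1) j * z j else 0)
    - z i * ∑ j ∈ Finset.Icc 1 i, (j : ℝ) * φ i j * z j
    - z i * ∑' k : ℕ, φ i (i + k) * z (i + k)

/-- The time interval `[0, T)`, with `T ≤ ∞`. -/
def timeInterval (T : EReal) : Set ℝ := {t : ℝ | 0 ≤ t ∧ (t : EReal) < T}

/-- `c : [0, T) → B⁺` solves the initial value problem for the Safronov-Dubovski equation with
initial value `c₀`; `c t i` is the concentration of the size `i` at the time `t`. The finiteness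
of `∫₀ᵗ ∑_{j ≥ 1} φ_{i,j} c_j` is that of a Lebesgue integral with values in `[0, ∞]`; together
with the continuity of `c_i` it makes the integrand of the last field integrable. -/
structure IsSolution (φ : ℕ → ℕ → ℝ) (c₀ : ℕ → ℝ) (T : EReal) (c : ℝ → ℕ → ℝ) : Prop where
  mem : ∀ t ∈ timeInterval T, MemBPlus (c t)
  initial : ∀ i : ℕ, 1 ≤ i → c 0 i = c₀ i
  continuous : ∀ i : ℕ, 1 ≤ i → ContinuousOn (fun t => c t i) (timeInterval T)
  bounded : ∃ M : ℝ, ∀ t ∈ timeInterval T, massNorm (c t) ≤ M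
  finite_integral : ∀ i : ℕ, 1 ≤ i → ∀ t ∈ timeInterval T,
    ∫⁻ h in Set.Ioc 0 t, ∑' k : ℕ, ENNReal.ofReal (φ i (k + 1) * c h (k + 1)) < ⊤
  integral_eq : ∀ i : ℕ, 1 ≤ i → ∀ t ∈ timeInterval T,
    c t i = c 0 i + ∫ h in (0 : ℝ)..t, rhs φ i (c h)

/-- The right-hand side of the non-conservative truncation of size `n` (for `n ≥ 2`) for the
size `i` at the state `z`. -/
def truncRhs (φ : ℕ → ℕ → ℝ) (n i : ℕ) (z : ℕ → ℝ) : ℝ :=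
  if i = 1 then
    - φ 1 1 * z 1 ^ 2 - z 1 * ∑ j ∈ Finset.Icc 1 n, φ 1 j * z j
  else if i = n then
    z (n - 1) * ∑ j ∈ Finset.Icc 1 (n - 1), (j : ℝ) * φ (n - 1) j * z j
  else
    z (i - 1) * ∑ j ∈ Finset.Icc 1 (i - 1), (j : ℝ) * φ (i - 1) j * z j
      - z i * ∑ j ∈ Finset.Icc 1 i, (j : ℝ) * φ i j * z j
      - z i * ∑ j ∈ Finset.Icc i n, φ i j * z j

/-- `u` solves the truncated system of size `n` on `[0, ∞)` with initial values `c₀ i`,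
`1 ≤ i ≤ n`; the derivative at the time `0` is the one from the right. -/
structure IsTruncSolution (φ : ℕ → ℕ → ℝ) (c₀ : ℕ → ℝ) (n : ℕ) (u : ℝ → ℕ → ℝ) : Prop where
  initial : ∀ i : ℕ, 1 ≤ i → i ≤ n → u 0 i = c₀ i
  deriv : ∀ i : ℕ, 1 ≤ i → i ≤ n → ∀ t : ℝ, 0 ≤ t →
    HasDerivWithinAt (fun s => u s i) (truncRhs φ n i (u t)) (Set.Ici 0) t

/-- `c` is a limit, for every size and every time `t ≥ 0`, of a subsequence of the solutions of
the truncated systems with initial value `c₀`. -/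
def IsTruncLimit (φ : ℕ → ℕ → ℝ) (c₀ : ℕ → ℝ) (c : ℝ → ℕ → ℝ) : Prop :=
  ∃ (N : ℕ → ℕ) (u : ℕ → ℝ → ℕ → ℝ), StrictMono N ∧ (∀ k, 2 ≤ N k) ∧
    (∀ k, IsTruncSolution φ c₀ (N k) (u k)) ∧
    ∀ i : ℕ, 1 ≤ i → ∀ t : ℝ, 0 ≤ t → Tendsto (fun k => u k t i) atTop (𝓝 (c t i))

end SafronovDubovski

end

/-!
All three classes of kernels satisfy `φ i j ≤ 2 (i + j)`. With
`growthRate φ z i = z i * ∑_{j ≤ i} j φ_{i,j} z_j`, summation by parts and the symmetry of `φ` show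
(`sum_mul_rhs`) that the sizes up to `n` lose mass at the rate
`(n + 1) growthRate φ z n + ∑_{i ≤ n} i z_i ∑_{j > n} φ_{i,j} z_j`.
For a state of mass at most `M` this is at most `8 M n² z_n + 4 M ∑_{j > n} j z_j`
(`abs_sum_mul_rhs_le`). Along a solution the time integral of the second term tends to `0` by
dominated convergence. The numbers `∫ n c_n` have a finite sum over `n`, so `n ∫ n c_n` is
arbitrarily small for infinitely many `n`. Passing to the limit along such `n` gives density
conservation (`IsSolution.hasSum_mass`).

For the limits of the truncated systems it remains to see that they are solutions on `[0, ∞)`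
(`IsTruncLimit.isSolution`). Solutions of the truncated systems are nonnegative and their mass is
at most that of the initial value, so the truncated right-hand sides are bounded uniformly in the
truncation. They converge pointwise to the full right-hand side because `φ_{i,j} → 0` as `j → ∞`
(`tendsto_sum_Icc_mul`), and dominated convergence gives the integrated equation.
-/

namespace SafronovDubovski

/-! ### Algebra of the mass balance -/

/-- The total rate at which particles of size `i` grow to size `i + 1` at the state `z`. It
vanishes for `i = 0`, the sum being empty. -/
def growthRate (φ : ℕ → ℕ → ℝ) (z : ℕ → ℝ) (i : ℕ) : ℝ :=
  z i * ∑ j ∈ Finset.Icc 1 i, (j : ℝ) * φ i j * z j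

theorem growthRate_zero (φ : ℕ → ℕ → ℝ) (z : ℕ → ℝ) : growthRate φ z 0 = 0 := by
  simp [growthRate]

theorem rhs_eq_growthRate (φ : ℕ → ℕ → ℝ) (z : ℕ → ℝ) {i : ℕ} (hi : 1 ≤ i) :
    rhs φ i z = growthRate φ z (i - 1) - growthRate φ z i
      - z i * ∑' k : ℕ, φ i (i + k) * z (i + k) := by
  unfold rhs
  split_ifs with h
  · rfl
  · obtain rfl : i = 1 := by omega
    rw [Nat.sub_self, growthRate_zero]; rfl

theorem truncRhs_of_lt (φ : ℕ → ℕ → ℝ) (z : ℕ → ℝ) {n i : ℕ} (hi : 1 ≤ i) (hin : i < n) :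
    truncRhs φ n i z = growthRate φ z (i - 1) - growthRate φ z i
      - z i * ∑ j ∈ Finset.Icc i n, φ i j * z j := by
  unfold truncRhs
  split_ifs with h h'
  · subst h
    simp [growthRate]; ring
  · omega
  · rfl

theorem truncRhs_self (φ : ℕ → ℕ → ℝ) (z : ℕ → ℝ) {n : ℕ} (hn : 2 ≤ n) :
    truncRhs φ n n z = growthRate φ z (n - 1) := by
  unfold truncRhs
  rw [if_neg (by omega), if_pos rfl]; rfl

theorem sum_range_succ_mul (z : ℕ → ℝ) (n : ℕ) :
    ∑ i ∈ Finset.range (n + 1), (i : ℝ) * z i = ∑ i ∈ Finset.Icc 1 n, (i : ℝ) * z i := by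
  rw [Finset.range_eq_Ico, Finset.sum_eq_sum_Ico_succ_bot (by omega)]
  simp only [Nat.cast_zero, zero_mul, zero_add]; rfl

theorem sum_mul_sub_pred (g : ℕ → ℝ) (h0 : g 0 = 0) (n : ℕ) :
    ∑ i ∈ Finset.Icc 1 n, (i : ℝ) * (g (i - 1) - g i)
      = ∑ i ∈ Finset.Icc 1 n, g i - (n + 1) * g n := by
  induction n with
  | zero => simp [h0]
  | succ n ih =>
    rw [Finset.sum_Icc_succ_top (by omega), Finset.sum_Icc_succ_top (by omega), ih]
    simp only [Nat.add_sub_cancel]; push_cast; ring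

theorem sum_growthRate {φ : ℕ → ℕ → ℝ} (hφ : IsKernel φ) (z : ℕ → ℝ) (n : ℕ) :
    ∑ i ∈ Finset.Icc 1 n, growthRate φ z i
      = ∑ i ∈ Finset.Icc 1 n, (i : ℝ) * (z i * ∑ j ∈ Finset.Icc i n, φ i j * z j) := by
  simp only [growthRate, Finset.mul_sum]
  rw [Finset.sum_comm' (t' := Finset.Icc 1 n) (s' := fun j => Finset.Icc j n)]
  · refine Finset.sum_congr rfl fun i hi => Finset.sum_congr rfl fun j hj => ?_
    rw [Finset.mem_Icc] at hi hj
    rw [hφ.symm j i (by omega) (by omega)]; ring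
  · intro i j; simp only [Finset.mem_Icc]; omega

theorem growthRate_nonneg {φ : ℕ → ℕ → ℝ} (hφ : IsKernel φ) {z : ℕ → ℝ} {i : ℕ}
    (hz : ∀ j, 1 ≤ j → j ≤ i → 0 ≤ z j) : 0 ≤ growthRate φ z i := by
  rcases Nat.eq_zero_or_pos i with rfl | hi
  · rw [growthRate_zero]
  refine mul_nonneg (hz i hi le_rfl) (Finset.sum_nonneg fun j hj => ?_)
  rw [Finset.mem_Icc] at hj
  exact mul_nonneg (mul_nonneg (Nat.cast_nonneg _) (hφ.nonneg i j hi hj.1)) (hz j hj.1 hj.2)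

/-- Each of the three classes consists of kernels of at most linear growth, which is all that the
proof uses of it. -/
theorem KernelClass.linear_growth {φ : ℕ → ℕ → ℝ} (h : KernelClass φ) {i j : ℕ}
    (hi : 1 ≤ i) (hj : 1 ≤ j) : φ i j ≤ 2 * ((i : ℝ) + j) := by
  have hi' : (1 : ℝ) ≤ i := by exact_mod_cast hi
  have hj' : (1 : ℝ) ≤ j := by exact_mod_cast hj
  rcases h with h | h | ⟨α, h0, h1, h⟩
  · refine (h i j hi hj).trans ((div_le_self (by positivity) (le_min hi' hj')).trans ?_)
    linarith
  · linarith [h i j hi hj]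
  · refine (h i j hi hj).trans ((Real.rpow_le_rpow_of_exponent_le (by linarith) h1).trans ?_)
    rw [Real.rpow_one]; linarith

theorem growthRate_le {φ : ℕ → ℕ → ℝ} (hφ : KernelClass φ) {z : ℕ → ℝ} {i : ℕ} {M : ℝ}
    (hi : 1 ≤ i) (hz : ∀ j, 1 ≤ j → j ≤ i → 0 ≤ z j)
    (hM : ∑ j ∈ Finset.Icc 1 i, (j : ℝ) * z j ≤ M) :
    growthRate φ z i ≤ z i * (4 * i * M) := by
  refine mul_le_mul_of_nonneg_left ?_ (hz i hi le_rfl)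
  refine le_trans ?_ (mul_le_mul_of_nonneg_left hM (by positivity))
  rw [Finset.mul_sum]
  refine Finset.sum_le_sum fun j hj => ?_
  rw [Finset.mem_Icc] at hj
  have h1 := hφ.linear_growth hi hj.1
  have h2 : (j : ℝ) ≤ i := by exact_mod_cast hj.2
  have h3 : 0 ≤ (j : ℝ) * z j := mul_nonneg (Nat.cast_nonneg _) (hz j hj.1 hj.2)
  nlinarith

theorem kernel_mul_le {φ : ℕ → ℕ → ℝ} (hφ : KernelClass φ) {z : ℕ → ℝ} {i j : ℕ}
    (hi : 1 ≤ i) (hij : i ≤ j) (hz : 0 ≤ z j) : φ i j * z j ≤ 4 * ((j : ℝ) * z j) := by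
  have h1 := hφ.linear_growth hi (hi.trans hij)
  have h2 : (i : ℝ) ≤ j := by exact_mod_cast hij
  nlinarith

namespace MemBPlus

variable {z : ℕ → ℝ}

theorem mul_nonneg (hz : MemBPlus z) (i : ℕ) : 0 ≤ (i : ℝ) * z i := by
  rcases Nat.eq_zero_or_pos i with rfl | hi
  · simp
  · exact _root_.mul_nonneg (Nat.cast_nonneg _) (hz.nonneg i hi)

theorem mul_abs (hz : MemBPlus z) (i : ℕ) : (i : ℝ) * |z i| = (i : ℝ) * z i := by
  have := hz.mul_nonneg i
  rw [← abs_of_nonneg this, _root_.abs_mul, Nat.abs_cast]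

theorem summable_mul (hz : MemBPlus z) : Summable fun i : ℕ => (i : ℝ) * z i := by
  simpa only [hz.mul_abs] using hz.summable

theorem massNorm_eq (hz : MemBPlus z) : massNorm z = ∑' i : ℕ, (i : ℝ) * z i := by
  simp only [massNorm, hz.mul_abs]

theorem sum_le (hz : MemBPlus z) {M : ℝ} (hM : massNorm z ≤ M) (s : Finset ℕ) :
    ∑ i ∈ s, (i : ℝ) * z i ≤ M :=
  (hz.summable_mul.sum_le_tsum s fun i _ => hz.mul_nonneg i).trans (hz.massNorm_eq ▸ hM)

theorem tsum_shift_le (hz : MemBPlus z) {M : ℝ} (hM : massNorm z ≤ M) (m : ℕ) :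
    ∑' k : ℕ, ((m + k : ℕ) : ℝ) * z (m + k) ≤ M :=
  ((hz.summable_mul.comp_injective (add_right_injective m)).tsum_le_of_sum_le
    fun s => by
      have := hz.sum_le hM (s.map ⟨_, add_right_injective m⟩)
      simpa using this)

theorem summable_shift (hz : MemBPlus z) (m : ℕ) :
    Summable fun k : ℕ => ((m + k : ℕ) : ℝ) * z (m + k) :=
  hz.summable_mul.comp_injective (add_right_injective m)

theorem summable_kernel {φ : ℕ → ℕ → ℝ} (hφ : IsKernel φ) (hc : KernelClass φ)
    (hz : MemBPlus z) {i m : ℕ} (hi : 1 ≤ i) (him : i ≤ m) :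
    Summable fun k : ℕ => φ i (m + k) * z (m + k) :=
  Summable.of_nonneg_of_le
    (fun k => _root_.mul_nonneg (hφ.nonneg _ _ hi (by omega)) (hz.nonneg _ (by omega)))
    (fun k => kernel_mul_le hc hi (by omega) (hz.nonneg _ (by omega)))
    ((hz.summable_shift m).mul_left 4)

theorem tsum_kernel_nonneg {φ : ℕ → ℕ → ℝ} (hφ : IsKernel φ)
    (hz : MemBPlus z) {i m : ℕ} (hi : 1 ≤ i) (him : i ≤ m) :
    0 ≤ ∑' k : ℕ, φ i (m + k) * z (m + k) :=
  tsum_nonneg fun k =>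
    _root_.mul_nonneg (hφ.nonneg _ _ hi (by omega)) (hz.nonneg _ (by omega))

theorem tsum_kernel_le {φ : ℕ → ℕ → ℝ} (hφ : IsKernel φ) (hc : KernelClass φ)
    (hz : MemBPlus z) {i m : ℕ} (hi : 1 ≤ i) (him : i ≤ m) :
    ∑' k : ℕ, φ i (m + k) * z (m + k) ≤ 4 * ∑' k : ℕ, ((m + k : ℕ) : ℝ) * z (m + k) := by
  rw [← tsum_mul_left]
  exact (hz.summable_kernel hφ hc hi him).tsum_le_tsum
    (fun k => kernel_mul_le hc hi (by omega) (hz.nonneg _ (by omega)))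
    ((hz.summable_shift m).mul_left 4)

end MemBPlus

/-- The mass of the sizes up to `n` is lost in two ways only: particles grow from size `n` to
size `n + 1`, and particles of size at most `n` are absorbed by larger ones. -/
theorem sum_mul_rhs {φ : ℕ → ℕ → ℝ} (hφ : IsKernel φ) (hc : KernelClass φ) {z : ℕ → ℝ}
    (hz : MemBPlus z) (n : ℕ) :
    ∑ i ∈ Finset.Icc 1 n, (i : ℝ) * rhs φ i z
      = -((n + 1) * growthRate φ z n)
        - ∑ i ∈ Finset.Icc 1 n, (i : ℝ) * z i * ∑' k : ℕ, φ i (n + 1 + k) * z (n + 1 + k) := by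
  have key : ∀ i ∈ Finset.Icc 1 n, (i : ℝ) * rhs φ i z
      = (i : ℝ) * (growthRate φ z (i - 1) - growthRate φ z i)
        - (i : ℝ) * (z i * ∑ j ∈ Finset.Icc i n, φ i j * z j)
        - (i : ℝ) * z i * ∑' k : ℕ, φ i (n + 1 + k) * z (n + 1 + k) := by
    intro i hi
    rw [Finset.mem_Icc] at hi
    rw [rhs_eq_growthRate φ z hi.1,
      ← (hz.summable_kernel hφ hc hi.1 le_rfl).sum_add_tsum_nat_add (n + 1 - i)]
    have h1 : ∑ k ∈ Finset.range (n + 1 - i), φ i (i + k) * z (i + k)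
        = ∑ j ∈ Finset.Icc i n, φ i j * z j := by
      rw [← Finset.sum_Ico_eq_sum_range (fun j => φ i j * z j) i (n + 1)]; rfl
    have h2 : ∀ k, i + (k + (n + 1 - i)) = n + 1 + k := fun k => by omega
    simp only [h1, h2]; ring
  rw [Finset.sum_congr rfl key, Finset.sum_sub_distrib, Finset.sum_sub_distrib,
    sum_mul_sub_pred _ (growthRate_zero φ z), sum_growthRate hφ]
  ring

theorem abs_sum_mul_rhs_le {φ : ℕ → ℕ → ℝ} (hφ : IsKernel φ) (hc : KernelClass φ) {z : ℕ → ℝ}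
    (hz : MemBPlus z) {M : ℝ} (hM : massNorm z ≤ M) {n : ℕ} (hn : 1 ≤ n) :
    |∑ i ∈ Finset.Icc 1 n, (i : ℝ) * rhs φ i z|
      ≤ 8 * M * (n * (n * z n))
        + 4 * M * ∑' k : ℕ, ((n + 1 + k : ℕ) : ℝ) * z (n + 1 + k) := by
  have hn' : (1 : ℝ) ≤ n := by exact_mod_cast hn
  set S := ∑' k : ℕ, ((n + 1 + k : ℕ) : ℝ) * z (n + 1 + k)
  have hS0 : 0 ≤ S := tsum_nonneg fun k => hz.mul_nonneg _
  have hsum := hz.sum_le hM (Finset.Icc 1 n)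
  have hM0 : 0 ≤ M := (Finset.sum_nonneg fun i _ => hz.mul_nonneg i).trans hsum
  have hg0 : 0 ≤ growthRate φ z n := growthRate_nonneg hφ fun j hj _ => hz.nonneg j hj
  have hg := growthRate_le hc hn (fun j hj _ => hz.nonneg j hj) hsum
  have hzn := hz.nonneg n hn
  have h0 : 0 ≤ ∑ i ∈ Finset.Icc 1 n, (i : ℝ) * z i *
      ∑' k : ℕ, φ i (n + 1 + k) * z (n + 1 + k) := by
    refine Finset.sum_nonneg fun i hi => ?_
    rw [Finset.mem_Icc] at hi
    exact mul_nonneg (hz.mul_nonneg i) (hz.tsum_kernel_nonneg hφ hi.1 (by omega))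
  have h1 : ∑ i ∈ Finset.Icc 1 n, (i : ℝ) * z i *
      ∑' k : ℕ, φ i (n + 1 + k) * z (n + 1 + k) ≤ 4 * M * S := by
    calc _ ≤ ∑ i ∈ Finset.Icc 1 n, (i : ℝ) * z i * (4 * S) := by
          refine Finset.sum_le_sum fun i hi => ?_
          rw [Finset.mem_Icc] at hi
          exact mul_le_mul_of_nonneg_left (hz.tsum_kernel_le hφ hc hi.1 (by omega))
            (hz.mul_nonneg i)
      _ = (∑ i ∈ Finset.Icc 1 n, (i : ℝ) * z i) * (4 * S) := by rw [Finset.sum_mul]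
      _ ≤ M * (4 * S) := mul_le_mul_of_nonneg_right hsum (by positivity)
      _ = _ := by ring
  have h2 : (n + 1) * growthRate φ z n ≤ 8 * M * (n * (n * z n)) := by
    calc (n + 1) * growthRate φ z n ≤ (2 * n) * (z n * (4 * n * M)) :=
          mul_le_mul (by linarith) hg hg0 (by positivity)
      _ = _ := by ring
  have h3 : 0 ≤ (n + 1) * growthRate φ z n := by positivity
  rw [sum_mul_rhs hφ hc hz, abs_le]
  constructor <;> linarith

/-! ### Density conservation for solutions -/

/-- The terms of a convergent series of nonnegative numbers are not eventually bounded below by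
`ε / n`. -/
theorem frequently_mul_lt_of_summable {a : ℕ → ℝ} (ha : Summable a) {ε : ℝ} (hε : 0 < ε) :
    ∃ᶠ n : ℕ in atTop, n * a n < ε := by
  intro h
  have h' : ∀ᶠ n : ℕ in atTop, ‖ε * (1 / (n : ℝ))‖ ≤ a n := by
    filter_upwards [h, eventually_ge_atTop 1] with n hn h1
    have : (0 : ℝ) < n := by exact_mod_cast h1
    rw [Real.norm_of_nonneg (by positivity), mul_one_div, div_le_iff₀ this]
    linarith
  have hs : Summable fun n : ℕ => ε * (1 / (n : ℝ)) := by
    refine Summable.of_norm_bounded_eventually_nat ha h'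
  exact Real.not_summable_one_div_natCast ((summable_mul_left_iff hε.ne').1 hs)

theorem timeInterval_mono {T : EReal} {s t : ℝ} (hs : 0 ≤ s) (hst : s ≤ t)
    (ht : t ∈ timeInterval T) : s ∈ timeInterval T :=
  ⟨hs, (EReal.coe_le_coe_iff.2 hst).trans_lt ht.2⟩

theorem intervalIntegrable_of_bound {t C : ℝ} {f : ℝ → ℝ}
    (hf : AEStronglyMeasurable f (volume.restrict (uIoc 0 t))) (hC : ∀ s ∈ uIoc 0 t, ‖f s‖ ≤ C) :
    IntervalIntegrable f volume 0 t := by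
  refine (intervalIntegrable_const (c := C)).mono_fun hf ?_
  filter_upwards [ae_restrict_mem measurableSet_uIoc] with s hs
  exact (hC s hs).trans (le_abs_self C)

namespace IsSolution

variable {φ : ℕ → ℕ → ℝ} {c₀ : ℕ → ℝ} {T : EReal} {c : ℝ → ℕ → ℝ}

theorem uIoc_mem (h : IsSolution φ c₀ T c) {t : ℝ} (ht : t ∈ timeInterval T) {s : ℝ}
    (hs : s ∈ uIoc 0 t) : MemBPlus (c s) := by
  rw [uIoc_of_le ht.1] at hs
  exact h.mem s (timeInterval_mono hs.1.le hs.2 ht)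

theorem continuousOn_uIcc (h : IsSolution φ c₀ T c) {t : ℝ} (ht : t ∈ timeInterval T) {i : ℕ}
    (hi : 1 ≤ i) : ContinuousOn (fun s => c s i) (uIcc 0 t) := by
  rw [uIcc_of_le ht.1]
  exact (h.continuous i hi).mono fun s hs => timeInterval_mono hs.1 hs.2 ht

theorem aestronglyMeasurable (h : IsSolution φ c₀ T c) {t : ℝ} (ht : t ∈ timeInterval T) {i : ℕ}
    (hi : 1 ≤ i) : AEStronglyMeasurable (fun s => c s i) (volume.restrict (uIoc 0 t)) :=
  ((h.continuousOn_uIcc ht hi).mono uIoc_subset_uIcc).aestronglyMeasurable measurableSet_uIoc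

/-- A weighted tail series of a solution is measurable in time, as the limit of its partial
sums. -/
theorem aestronglyMeasurable_tsum (h : IsSolution φ c₀ T c) {t : ℝ} (ht : t ∈ timeInterval T)
    (w : ℕ → ℝ) {m : ℕ} (hm : 1 ≤ m)
    (hs : ∀ s ∈ uIoc 0 t, Summable fun k : ℕ => w k * c s (m + k)) :
    AEStronglyMeasurable (fun s => ∑' k : ℕ, w k * c s (m + k)) (volume.restrict (uIoc 0 t)) := by
  refine aestronglyMeasurable_of_tendsto_ae atTop
    (f := fun n s => ∑ k ∈ Finset.range n, w k * c s (m + k)) (fun n => ?_) ?_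
  · exact Finset.aestronglyMeasurable_fun_sum _ fun k _ =>
      (h.aestronglyMeasurable ht (by omega)).const_mul _
  · filter_upwards [ae_restrict_mem measurableSet_uIoc] with s hs'
    exact (hs s hs').hasSum.tendsto_sum_nat

theorem intervalIntegrable_rhs (h : IsSolution φ c₀ T c) (hφ : IsKernel φ) (hc : KernelClass φ)
    {t : ℝ} (ht : t ∈ timeInterval T) {i : ℕ} (hi : 1 ≤ i) :
    IntervalIntegrable (fun s => rhs φ i (c s)) volume 0 t := by
  obtain ⟨M, hM⟩ := h.bounded
  have hg : ∀ m, IntervalIntegrable (fun s => growthRate φ (c s) m) volume 0 t := by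
    intro m
    rcases Nat.eq_zero_or_pos m with rfl | hm
    · simp [growthRate_zero]
    refine ContinuousOn.intervalIntegrable ?_
    refine (h.continuousOn_uIcc ht hm).mul (continuousOn_finsetSum _ fun j hj => ?_)
    exact continuousOn_const.mul (h.continuousOn_uIcc ht (Finset.mem_Icc.1 hj).1)
  have hL : IntervalIntegrable (fun s => ∑' k : ℕ, φ i (i + k) * c s (i + k)) volume 0 t := by
    refine intervalIntegrable_of_bound (C := 4 * M) (h.aestronglyMeasurable_tsum ht _ hi
      fun s hs => (h.uIoc_mem ht hs).summable_kernel hφ hc hi le_rfl) fun s hs => ?_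
    have hz := h.uIoc_mem ht hs
    rw [uIoc_of_le ht.1] at hs
    rw [Real.norm_of_nonneg (hz.tsum_kernel_nonneg hφ hi le_rfl)]
    refine (hz.tsum_kernel_le hφ hc hi le_rfl).trans ?_
    have := hz.tsum_shift_le (hM s (timeInterval_mono hs.1.le hs.2 ht)) i
    linarith
  simp only [rhs_eq_growthRate φ _ hi]
  exact ((hg _).sub (hg _)).sub (hL.continuousOn_mul (h.continuousOn_uIcc ht hi))

/-- Density conservation. The mass lost by the sizes up to `n` is at most a multiple of
`n ∫ n cₙ` plus a multiple of the integral of the mass above `n`. The second term tends to `0`,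
and the first is small for infinitely many `n` since `∑ ∫ n cₙ` converges. -/
theorem hasSum_mass (h : IsSolution φ c₀ T c) (hφ : IsKernel φ) (hc : KernelClass φ)
    {t : ℝ} (ht : t ∈ timeInterval T) :
    HasSum (fun i : ℕ => (i : ℝ) * c t i) (∑' i : ℕ, (i : ℝ) * c 0 i) := by
  obtain ⟨M, hM⟩ := h.bounded
  have h0 : (0 : ℝ) ∈ timeInterval T := timeInterval_mono le_rfl ht.1 ht
  have hM' : ∀ s ∈ uIoc 0 t, massNorm (c s) ≤ M := fun s hs => by
    rw [uIoc_of_le ht.1] at hs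
    exact hM s (timeInterval_mono hs.1.le hs.2 ht)
  have hM0 : 0 ≤ M := le_trans (tsum_nonneg fun i => by positivity) (hM 0 h0)
  have hpart : ∀ z : ℕ → ℝ, MemBPlus z → Tendsto (fun n : ℕ => ∑ i ∈ Finset.Icc 1 n, (i : ℝ) * z i)
      atTop (𝓝 (∑' i : ℕ, (i : ℝ) * z i)) := by
    intro z hz
    refine ((tendsto_add_atTop_iff_nat 1).2 hz.summable_mul.hasSum.tendsto_sum_nat).congr ?_
    exact fun n => sum_range_succ_mul z n
  have hci : ∀ n : ℕ, IntervalIntegrable (fun s => (n : ℝ) * c s n) volume 0 t := by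
    intro n
    rcases Nat.eq_zero_or_pos n with rfl | hn
    · simp
    · exact (continuousOn_const.mul (h.continuousOn_uIcc ht hn)).intervalIntegrable
  set a : ℕ → ℝ := fun n => ∫ s in (0 : ℝ)..t, (n : ℝ) * c s n with ha
  set tail : ℕ → ℝ → ℝ := fun n s => ∑' k : ℕ, ((n + 1 + k : ℕ) : ℝ) * c s (n + 1 + k)
  have hasum : Summable a := by
    refine summable_of_sum_range_le (c := t * M) (fun n => ?_) fun n => ?_
    · exact intervalIntegral.integral_nonneg ht.1 fun s hs =>
        (h.mem s (timeInterval_mono hs.1 hs.2 ht)).mul_nonneg n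
    · have hsi : IntervalIntegrable (fun s => ∑ i ∈ Finset.range n, (i : ℝ) * c s i)
          volume 0 t := by
        simpa only [Finset.sum_fn] using
          IntervalIntegrable.sum (Finset.range n) (fun i _ => hci i)
      rw [← intervalIntegral.integral_finsetSum fun i _ => hci i]
      calc _ ≤ ∫ _ in (0 : ℝ)..t, M := by
            refine intervalIntegral.integral_mono_on ht.1
              hsi intervalIntegrable_const fun s hs => ?_
            have hs' := timeInterval_mono hs.1 hs.2 ht
            exact (h.mem s hs').sum_le (hM s hs') _
        _ = t * M := by simp
  have htm : ∀ n, AEStronglyMeasurable (tail n) (volume.restrict (uIoc 0 t)) := fun n =>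
    h.aestronglyMeasurable_tsum ht _ (by omega) fun s hs =>
      (h.uIoc_mem ht hs).summable_shift (n + 1)
  have htb : ∀ n, ∀ s ∈ uIoc 0 t, ‖tail n s‖ ≤ M := fun n s hs => by
    have hz := h.uIoc_mem ht hs
    rw [Real.norm_of_nonneg (tsum_nonneg fun k => hz.mul_nonneg _)]
    exact hz.tsum_shift_le (hM' s hs) (n + 1)
  have hti : ∀ n, IntervalIntegrable (tail n) volume 0 t := fun n =>
    intervalIntegrable_of_bound (htm n) (htb n)
  have htail0 : Tendsto (fun n => ∫ s in (0 : ℝ)..t, tail n s) atTop (𝓝 0) := by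
    have := intervalIntegral.tendsto_integral_filter_of_dominated_convergence
      (μ := volume) (a := 0) (b := t) (F := tail) (f := fun _ => (0 : ℝ)) (l := atTop)
      (fun _ => M) (Eventually.of_forall htm)
      (Eventually.of_forall fun n => Eventually.of_forall (htb n)) intervalIntegrable_const
      (Eventually.of_forall fun s _ => ?_)
    · simpa using this
    · have := (tendsto_add_atTop_iff_nat 1).2 (tendsto_sum_nat_add fun i : ℕ => (i : ℝ) * c s i)
      refine this.congr fun n => tsum_congr fun k => ?_
      rw [add_comm k (n + 1)]
  have hdiff : ∀ n : ℕ, 1 ≤ n →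
      |∑ i ∈ Finset.Icc 1 n, (i : ℝ) * c t i - ∑ i ∈ Finset.Icc 1 n, (i : ℝ) * c 0 i|
        ≤ 8 * M * (n * a n) + 4 * M * ∫ s in (0 : ℝ)..t, tail n s := by
    intro n hn
    have hri : ∀ i ∈ Finset.Icc 1 n,
        IntervalIntegrable (fun s => (i : ℝ) * rhs φ i (c s)) volume 0 t := fun i hi =>
      (h.intervalIntegrable_rhs hφ hc ht (Finset.mem_Icc.1 hi).1).const_mul _
    have e1 : ∑ i ∈ Finset.Icc 1 n, (i : ℝ) * c t i - ∑ i ∈ Finset.Icc 1 n, (i : ℝ) * c 0 i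
        = ∫ s in (0 : ℝ)..t, ∑ i ∈ Finset.Icc 1 n, (i : ℝ) * rhs φ i (c s) := by
      rw [intervalIntegral.integral_finsetSum hri, ← Finset.sum_sub_distrib]
      refine Finset.sum_congr rfl fun i hi => ?_
      rw [intervalIntegral.integral_const_mul, h.integral_eq i (Finset.mem_Icc.1 hi).1 t ht]
      ring
    have e2 : 8 * M * (n * a n) + 4 * M * ∫ s in (0 : ℝ)..t, tail n s
        = ∫ s in (0 : ℝ)..t, (8 * M * (n * (n * c s n)) + 4 * M * tail n s) := by
      rw [intervalIntegral.integral_add (((hci n).const_mul _).const_mul _)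
        ((hti n).const_mul _)]
      simp only [intervalIntegral.integral_const_mul, ha]
    rw [e1, e2, ← Real.norm_eq_abs]
    refine intervalIntegral.norm_integral_le_of_norm_le ht.1 (Eventually.of_forall fun s hs => ?_)
      ((((hci n).const_mul _).const_mul _).add ((hti n).const_mul _))
    have hs' := timeInterval_mono hs.1.le hs.2 ht
    exact abs_sum_mul_rhs_le hφ hc (h.mem s hs') (hM s hs') hn
  have hlim : Tendsto (fun n : ℕ =>
      |∑ i ∈ Finset.Icc 1 n, (i : ℝ) * c t i - ∑ i ∈ Finset.Icc 1 n, (i : ℝ) * c 0 i|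
        - 4 * M * ∫ s in (0 : ℝ)..t, tail n s) atTop
      (𝓝 (|∑' i : ℕ, (i : ℝ) * c t i - ∑' i : ℕ, (i : ℝ) * c 0 i|)) := by
    simpa using (((hpart _ (h.mem t ht)).sub (hpart _ (h.mem 0 h0))).abs).sub
      (htail0.const_mul (4 * M))
  have hle : |∑' i : ℕ, (i : ℝ) * c t i - ∑' i : ℕ, (i : ℝ) * c 0 i| ≤ 0 := by
    refine le_of_forall_pos_le_add fun ε hε => ?_
    rw [zero_add]
    by_contra! hlt
    have hδ : 0 < ε / (8 * M + 1) := by positivity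
    obtain ⟨n, hn, hn', hn1⟩ := ((frequently_mul_lt_of_summable hasum hδ).and_eventually
      ((hlim.eventually (lt_mem_nhds hlt)).and (eventually_ge_atTop 1))).exists
    have h1 := hdiff n hn1
    rw [lt_div_iff₀ (by positivity)] at hn
    have hna : 0 ≤ n * a n := mul_nonneg (Nat.cast_nonneg _)
      (intervalIntegral.integral_nonneg ht.1 fun s hs =>
        (h.mem s (timeInterval_mono hs.1 hs.2 ht)).mul_nonneg n)
    nlinarith
  rw [← sub_eq_zero.1 (abs_nonpos_iff.1 hle)]
  exact (h.mem t ht).summable_mul.hasSum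

end IsSolution

/-! ### The truncated systems -/

/-- A solution of the linear equation `y' = p - a y` with `p ≥ 0` stays nonnegative. -/
theorem nonneg_of_hasDerivWithinAt {y a p : ℝ → ℝ} (ha : ContinuousOn a (Ici 0))
    (hp : ∀ t, 0 ≤ t → 0 ≤ p t)
    (hy : ∀ t, 0 ≤ t → HasDerivWithinAt y (p t - a t * y t) (Ici 0) t) (hy0 : 0 ≤ y 0)
    {t : ℝ} (ht : 0 ≤ t) : 0 ≤ y t := by
  have hac : Continuous fun s => a (max s 0) :=
    ha.comp_continuous (by fun_prop) fun s => le_max_right s 0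
  set A : ℝ → ℝ := fun t => ∫ s in (0 : ℝ)..t, a (max s 0) with hA
  have hd : ∀ s, 0 ≤ s →
      HasDerivWithinAt (fun s => Real.exp (A s) * y s) (Real.exp (A s) * p s) (Ici 0) s := by
    intro s hs
    have h1 : HasDerivAt A (a s) s := by
      have := (hac.integral_hasStrictDerivAt 0 s).hasDerivAt
      rwa [max_eq_left hs] at this
    refine (h1.exp.hasDerivWithinAt.mul (hy s hs)).congr_deriv ?_
    ring
  have hmono : MonotoneOn (fun s => Real.exp (A s) * y s) (Ici 0) := by
    refine monotoneOn_of_hasDerivWithinAt_nonneg (convex_Ici 0)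
      (f' := fun s => Real.exp (A s) * p s)
      (fun s hs => (hd s hs).continuousWithinAt) (fun s hs => ?_) fun s hs => ?_
    · exact (hd s (interior_subset hs)).mono interior_subset
    · exact mul_nonneg (Real.exp_nonneg _) (hp s (interior_subset hs))
  have h := hmono self_mem_Ici ht ht
  simp only at h
  exact nonneg_of_mul_nonneg_right (le_trans (mul_nonneg (Real.exp_nonneg _) hy0) h)
    (Real.exp_pos _)

/-- The truncation does not create mass. -/
theorem sum_mul_truncRhs_nonpos {φ : ℕ → ℕ → ℝ} (hφ : IsKernel φ) {z : ℕ → ℝ} {n : ℕ}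
    (hn : 2 ≤ n) (hz : ∀ j, 1 ≤ j → j ≤ n → 0 ≤ z j) :
    ∑ i ∈ Finset.Icc 1 n, (i : ℝ) * truncRhs φ n i z ≤ 0 := by
  obtain ⟨m, rfl⟩ : ∃ m, n = m + 1 := ⟨n - 1, by omega⟩
  rw [Finset.sum_Icc_succ_top (by omega), truncRhs_self φ z hn, Nat.add_sub_cancel]
  have key : ∀ i ∈ Finset.Icc 1 m, (i : ℝ) * truncRhs φ (m + 1) i z
      ≤ (i : ℝ) * (growthRate φ z (i - 1) - growthRate φ z i)
        - (i : ℝ) * (z i * ∑ j ∈ Finset.Icc i m, φ i j * z j) := by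
    intro i hi
    rw [Finset.mem_Icc] at hi
    rw [truncRhs_of_lt φ z hi.1 (by omega), ← mul_sub]
    refine mul_le_mul_of_nonneg_left (sub_le_sub_left (mul_le_mul_of_nonneg_left ?_
      (hz i hi.1 (by omega))) _) (Nat.cast_nonneg _)
    refine Finset.sum_le_sum_of_subset_of_nonneg
      (Finset.Icc_subset_Icc_right (by omega)) fun j hj _ => ?_
    rw [Finset.mem_Icc] at hj
    exact mul_nonneg (hφ.nonneg i j hi.1 (by omega)) (hz j (by omega) hj.2)
  have h := Finset.sum_le_sum key
  rw [Finset.sum_sub_distrib, sum_mul_sub_pred _ (growthRate_zero φ z), sum_growthRate hφ] at h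
  push_cast
  linarith

/-- A bound on the truncated right-hand side that does not depend on the truncation. -/
theorem abs_truncRhs_le {φ : ℕ → ℕ → ℝ} (hφ : IsKernel φ) (hc : KernelClass φ) {z : ℕ → ℝ}
    {n i : ℕ} {M : ℝ} (hi : 1 ≤ i) (hin : i < n) (hz : ∀ j, 1 ≤ j → j ≤ n → 0 ≤ z j)
    (hM : ∑ j ∈ Finset.Icc 1 n, (j : ℝ) * z j ≤ M) :
    |truncRhs φ n i z| ≤ 8 * M ^ 2 := by
  have hmz : ∀ j ∈ Finset.Icc 1 n, 0 ≤ (j : ℝ) * z j := fun j hj => by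
    rw [Finset.mem_Icc] at hj
    exact mul_nonneg (Nat.cast_nonneg _) (hz j hj.1 hj.2)
  have hM0 : 0 ≤ M := (Finset.sum_nonneg hmz).trans hM
  have hsub : ∀ s ⊆ Finset.Icc 1 n, ∑ j ∈ s, (j : ℝ) * z j ≤ M := fun s hs =>
    (Finset.sum_le_sum_of_subset_of_nonneg hs fun j hj _ => hmz j hj).trans hM
  have hone : ∀ j, 1 ≤ j → j ≤ n → (j : ℝ) * z j ≤ M := fun j h1 h2 => by
    simpa using hsub {j} (by simp [h1, h2])
  have hgrow : ∀ m < n, 0 ≤ growthRate φ z m ∧ growthRate φ z m ≤ 4 * M ^ 2 := by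
    intro m hm
    refine ⟨growthRate_nonneg hφ fun j h1 h2 => hz j h1 (by omega), ?_⟩
    rcases Nat.eq_zero_or_pos m with rfl | hm0
    · rw [growthRate_zero]; positivity
    · have := growthRate_le hc hm0 (fun j h1 h2 => hz j h1 (by omega))
        (hsub _ (Finset.Icc_subset_Icc_right hm.le))
      have h2 := mul_le_mul_of_nonneg_right (hone m hm0 hm.le) hM0
      nlinarith
  have hzi : z i ≤ M := by
    have h1 : (1 : ℝ) ≤ i := by exact_mod_cast hi
    nlinarith [hone i hi hin.le, hz i hi hin.le]
  have hL0 : 0 ≤ ∑ j ∈ Finset.Icc i n, φ i j * z j := Finset.sum_nonneg fun j hj => by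
    rw [Finset.mem_Icc] at hj
    exact mul_nonneg (hφ.nonneg i j hi (by omega)) (hz j (by omega) hj.2)
  have hL : ∑ j ∈ Finset.Icc i n, φ i j * z j ≤ 4 * M := by
    refine le_trans ?_ (mul_le_mul_of_nonneg_left
      (hsub _ (Finset.Icc_subset_Icc_left hi)) (by norm_num : (0 : ℝ) ≤ 4))
    rw [Finset.mul_sum]
    refine Finset.sum_le_sum fun j hj => ?_
    rw [Finset.mem_Icc] at hj
    exact kernel_mul_le hc hi hj.1 (hz j (by omega) hj.2)
  have h1 := mul_nonneg (hz i hi hin.le) hL0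
  have h2 := mul_le_mul hzi hL hL0 hM0
  have h3 := hgrow i hin
  have h4 := hgrow (i - 1) (by omega)
  rw [truncRhs_of_lt φ z hi hin, abs_le]
  constructor <;> nlinarith

namespace IsTruncSolution

variable {φ : ℕ → ℕ → ℝ} {c₀ : ℕ → ℝ} {n : ℕ} {u : ℝ → ℕ → ℝ}

theorem continuousOn (h : IsTruncSolution φ c₀ n u) {i : ℕ} (hi : 1 ≤ i) (hin : i ≤ n) :
    ContinuousOn (fun t => u t i) (Ici 0) :=
  fun t ht => (h.deriv i hi hin t ht).continuousWithinAt

theorem continuousOn_sum (h : IsTruncSolution φ c₀ n u) (w : ℕ → ℝ) {s : Finset ℕ}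
    (hs : s ⊆ Finset.Icc 1 n) : ContinuousOn (fun t => ∑ j ∈ s, w j * u t j) (Ici 0) :=
  continuousOn_finsetSum _ fun j hj => by
    have := Finset.mem_Icc.1 (hs hj)
    exact continuousOn_const.mul (h.continuousOn this.1 this.2)

theorem continuousOn_growthRate (h : IsTruncSolution φ c₀ n u) {i : ℕ} (hin : i ≤ n) :
    ContinuousOn (fun t => growthRate φ (u t) i) (Ici 0) := by
  rcases Nat.eq_zero_or_pos i with rfl | hi
  · simp only [growthRate_zero]; exact continuousOn_const
  · exact (h.continuousOn hi hin).mul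
      (h.continuousOn_sum _ (Finset.Icc_subset_Icc_right hin))

theorem continuousOn_truncRhs (h : IsTruncSolution φ c₀ n u) {i : ℕ} (hi : 1 ≤ i) (hin : i < n) :
    ContinuousOn (fun t => truncRhs φ n i (u t)) (Ici 0) := by
  simp only [truncRhs_of_lt φ _ hi hin]
  exact ((h.continuousOn_growthRate (by omega)).sub (h.continuousOn_growthRate hin.le)).sub
    ((h.continuousOn hi hin.le).mul (h.continuousOn_sum _ (Finset.Icc_subset_Icc_left hi)))

/-- Solutions of the truncated system are nonnegative, by induction on the size: the gain of the
size `i` involves smaller sizes only, and its loss is proportional to `uᵢ`. -/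
theorem nonneg (h : IsTruncSolution φ c₀ n u) (hφ : IsKernel φ) (hc₀ : MemBPlus c₀)
    (hn : 2 ≤ n) {i : ℕ} (hi : 1 ≤ i) (hin : i ≤ n) {t : ℝ} (ht : 0 ≤ t) : 0 ≤ u t i := by
  induction i using Nat.strong_induction_on generalizing t with
  | _ i ih =>
    have hg : ∀ s, 0 ≤ s → 0 ≤ growthRate φ (u s) (i - 1) := fun s hs =>
      growthRate_nonneg hφ fun j h1 h2 => ih j (by omega) h1 (by omega) hs
    have h0 : 0 ≤ u 0 i := by rw [h.initial i hi hin]; exact hc₀.nonneg i hi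
    rcases hin.lt_or_eq with hlt | rfl
    · refine nonneg_of_hasDerivWithinAt (y := fun s => u s i)
        (a := fun s => ∑ j ∈ Finset.Icc 1 i, (j : ℝ) * φ i j * u s j
          + ∑ j ∈ Finset.Icc i n, φ i j * u s j)
        ((h.continuousOn_sum _ (Finset.Icc_subset_Icc_right hin)).add
          (h.continuousOn_sum _ (Finset.Icc_subset_Icc_left hi))) hg (fun s hs => ?_) h0 ht
      refine (h.deriv i hi hin s hs).congr_deriv ?_
      rw [truncRhs_of_lt φ _ hi hlt]
      simp only [growthRate]; ring
    · refine nonneg_of_hasDerivWithinAt (y := fun s => u s i) (a := fun _ => 0)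
        continuousOn_const hg
        (fun s hs => ?_) h0 ht
      refine (h.deriv i hi hin s hs).congr_deriv ?_
      rw [truncRhs_self φ _ hn]; ring

theorem sum_mul_le (h : IsTruncSolution φ c₀ n u) (hφ : IsKernel φ) (hc₀ : MemBPlus c₀)
    (hn : 2 ≤ n) {t : ℝ} (ht : 0 ≤ t) :
    ∑ i ∈ Finset.Icc 1 n, (i : ℝ) * u t i ≤ massNorm c₀ := by
  have hd : ∀ s, 0 ≤ s → HasDerivWithinAt (fun s => ∑ i ∈ Finset.Icc 1 n, (i : ℝ) * u s i)
      (∑ i ∈ Finset.Icc 1 n, (i : ℝ) * truncRhs φ n i (u s)) (Ici 0) s := fun s hs =>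
    HasDerivWithinAt.fun_sum fun i hi =>
      (h.deriv i (Finset.mem_Icc.1 hi).1 (Finset.mem_Icc.1 hi).2 s hs).const_mul _
  have hanti : AntitoneOn (fun s => ∑ i ∈ Finset.Icc 1 n, (i : ℝ) * u s i) (Ici 0) := by
    refine antitoneOn_of_hasDerivWithinAt_nonpos (convex_Ici 0)
      (f' := fun s => ∑ i ∈ Finset.Icc 1 n, (i : ℝ) * truncRhs φ n i (u s))
      (fun s hs => (hd s hs).continuousWithinAt)
      (fun s hs => (hd s (interior_subset hs)).mono interior_subset) fun s hs => ?_
    exact sum_mul_truncRhs_nonpos hφ hn fun j h1 h2 =>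
      h.nonneg hφ hc₀ hn h1 h2 (interior_subset hs)
  refine (hanti self_mem_Ici ht ht).trans ?_
  have : ∑ i ∈ Finset.Icc 1 n, (i : ℝ) * u 0 i = ∑ i ∈ Finset.Icc 1 n, (i : ℝ) * c₀ i :=
    Finset.sum_congr rfl fun i hi => by
      rw [h.initial i (Finset.mem_Icc.1 hi).1 (Finset.mem_Icc.1 hi).2]
  simp only [this]
  exact hc₀.sum_le le_rfl _

theorem abs_truncRhs_le (h : IsTruncSolution φ c₀ n u) (hφ : IsKernel φ) (hc : KernelClass φ)
    (hc₀ : MemBPlus c₀) (hn : 2 ≤ n) {i : ℕ} (hi : 1 ≤ i) (hin : i < n) {t : ℝ} (ht : 0 ≤ t) :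
    |truncRhs φ n i (u t)| ≤ 8 * massNorm c₀ ^ 2 :=
  SafronovDubovski.abs_truncRhs_le hφ hc hi hin (fun _ h1 h2 => h.nonneg hφ hc₀ hn h1 h2 ht)
    (h.sum_mul_le hφ hc₀ hn ht)

theorem integral_eq (h : IsTruncSolution φ c₀ n u) {i : ℕ} (hi : 1 ≤ i) (hin : i < n)
    {t : ℝ} (ht : 0 ≤ t) :
    u t i = c₀ i + ∫ s in (0 : ℝ)..t, truncRhs φ n i (u s) := by
  rw [intervalIntegral.integral_eq_sub_of_hasDerivAt_of_le ht
    ((h.continuousOn hi hin.le).mono Icc_subset_Ici_self)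
    (fun s hs => (h.deriv i hi hin.le s hs.1.le).hasDerivAt (Ici_mem_nhds hs.1)),
    h.initial i hi hin.le]
  · ring
  · refine ((h.continuousOn_truncRhs hi hin).mono ?_).intervalIntegrable
    rw [uIcc_of_le ht]
    exact Icc_subset_Ici_self

end IsTruncSolution

/-! ### The limit of the truncated systems -/

/-- Series with weights tending to `0` converge along sequences that converge termwise and have
bounded mass: no mass can reach the limit from infinity. -/
theorem tendsto_sum_Icc_mul {f : ℕ → ℝ} (hf : Tendsto f atTop (𝓝 0)) {N : ℕ → ℕ}
    (hN : Tendsto N atTop atTop) {w : ℕ → ℕ → ℝ} {z : ℕ → ℝ} {M : ℝ}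
    (hw : ∀ k j, 1 ≤ j → j ≤ N k → 0 ≤ w k j)
    (hwM : ∀ k, ∑ j ∈ Finset.Icc 1 (N k), (j : ℝ) * w k j ≤ M)
    (hz : MemBPlus z) (hzM : massNorm z ≤ M)
    (hlim : ∀ j, 1 ≤ j → Tendsto (fun k => w k j) atTop (𝓝 (z j))) {m : ℕ} (hm : 1 ≤ m)
    (hs : Summable fun k : ℕ => f (m + k) * z (m + k)) :
    Tendsto (fun k => ∑ j ∈ Finset.Icc m (N k), f j * w k j) atTop
      (𝓝 (∑' k : ℕ, f (m + k) * z (m + k))) := by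
  have hM0 : 0 ≤ M := le_trans (tsum_nonneg fun i => by positivity) hzM
  rw [Metric.tendsto_nhds]
  intro ε hε
  set δ := ε / (3 * (M + 1)) with hδ
  have hδ0 : 0 < δ := by positivity
  have hδM : δ * M < ε / 3 := by
    rw [hδ, div_mul_eq_mul_div, div_lt_div_iff₀ (by positivity) (by norm_num)]
    nlinarith
  obtain ⟨J, hJm, hJ⟩ : ∃ J, m ≤ J ∧ ∀ j, J ≤ j → |f j| ≤ δ := by
    have h1 : ∀ᶠ j in atTop, |f j| ≤ δ := by
      have := hf.abs
      rw [abs_zero] at this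
      exact this.eventually (ge_mem_nhds hδ0)
    obtain ⟨J, hJ⟩ := eventually_atTop.1 h1
    exact ⟨max m J, le_max_left _ _, fun j hj => hJ j ((le_max_right _ _).trans hj)⟩
  have hterm : ∀ j x, J ≤ j → 0 ≤ x → ‖f j * x‖ ≤ δ * ((j : ℝ) * x) := by
    intro j x hj hx
    have h1 : (1 : ℝ) ≤ j := by exact_mod_cast (by omega : 1 ≤ j)
    rw [Real.norm_eq_abs, abs_mul, abs_of_nonneg hx]
    exact mul_le_mul (hJ j hj) (by nlinarith) hx hδ0.le
  have hztail : ‖∑' k : ℕ, f (J + k) * z (J + k)‖ ≤ δ * M := by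
    refine (tsum_of_norm_bounded ((hz.summable_shift J).mul_left δ).hasSum
      fun k => hterm (J + k) _ (by omega) (hz.nonneg _ (by omega))).trans ?_
    rw [tsum_mul_left]
    exact mul_le_mul_of_nonneg_left (hz.tsum_shift_le hzM J) hδ0.le
  have hzsplit : ∑' k : ℕ, f (m + k) * z (m + k)
      = ∑ j ∈ Finset.Ico m J, f j * z j + ∑' k : ℕ, f (J + k) * z (J + k) := by
    rw [← hs.sum_add_tsum_nat_add (J - m), Finset.sum_Ico_eq_sum_range]
    have h2 : ∀ k, m + (k + (J - m)) = J + k := fun k => by omega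
    simp only [h2]
  have hhead : Tendsto (fun k => ∑ j ∈ Finset.Ico m J, f j * w k j) atTop
      (𝓝 (∑ j ∈ Finset.Ico m J, f j * z j)) :=
    tendsto_finsetSum _ fun j hj =>
      (hlim j (hm.trans (Finset.mem_Ico.1 hj).1)).const_mul _
  filter_upwards [Metric.tendsto_nhds.1 hhead (ε / 3) (by positivity),
    hN.eventually_ge_atTop J] with k hk hkN
  have hwsplit : ∑ j ∈ Finset.Icc m (N k), f j * w k j
      = ∑ j ∈ Finset.Ico m J, f j * w k j + ∑ j ∈ Finset.Icc J (N k), f j * w k j :=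
    (Finset.sum_Ico_consecutive (fun j => f j * w k j) hJm (by omega : J ≤ N k + 1)).symm
  have hwtail : ‖∑ j ∈ Finset.Icc J (N k), f j * w k j‖ ≤ δ * M := by
    calc _ ≤ ∑ j ∈ Finset.Icc J (N k), δ * ((j : ℝ) * w k j) := by
          refine norm_sum_le_of_le _ fun j hj => ?_
          rw [Finset.mem_Icc] at hj
          exact hterm j _ hj.1 (hw k j (by omega) hj.2)
      _ ≤ δ * M := by
          rw [← Finset.mul_sum]
          refine mul_le_mul_of_nonneg_left (le_trans ?_ (hwM k)) hδ0.le
          refine Finset.sum_le_sum_of_subset_of_nonneg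
            (Finset.Icc_subset_Icc_left (by omega)) fun j hj _ => ?_
          rw [Finset.mem_Icc] at hj
          exact mul_nonneg (Nat.cast_nonneg _) (hw k j hj.1 hj.2)
  rw [hwsplit, hzsplit, Real.dist_eq]
  rw [Real.dist_eq] at hk
  rw [Real.norm_eq_abs] at hztail hwtail
  rw [abs_lt] at hk ⊢
  rw [abs_le] at hztail hwtail
  constructor <;> linarith [hk.1, hk.2, hztail.1, hztail.2, hwtail.1, hwtail.2]

theorem tendsto_growthRate (φ : ℕ → ℕ → ℝ) {w : ℕ → ℕ → ℝ} {z : ℕ → ℝ}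
    (hlim : ∀ j, 1 ≤ j → Tendsto (fun k => w k j) atTop (𝓝 (z j))) (i : ℕ) :
    Tendsto (fun k => growthRate φ (w k) i) atTop (𝓝 (growthRate φ z i)) := by
  rcases Nat.eq_zero_or_pos i with rfl | hi
  · simp only [growthRate_zero]; exact tendsto_const_nhds
  · exact (hlim i hi).mul (tendsto_finsetSum _ fun j hj =>
      (hlim j (Finset.mem_Icc.1 hj).1).const_mul _)

/-- Limits of the truncated systems are global solutions. The decay of the kernel gives the
convergence of the loss terms, and the bound on the truncated right-hand sides allows passing to
the limit in the integrated equations. -/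
theorem IsTruncLimit.isSolution {φ : ℕ → ℕ → ℝ} (hφ : IsKernel φ) (hc : KernelClass φ)
    (hvanish : ∀ j : ℕ, 1 ≤ j → Tendsto (fun n : ℕ => φ n j) atTop (𝓝 0))
    {c₀ : ℕ → ℝ} (hc₀ : MemBPlus c₀) {c : ℝ → ℕ → ℝ} (h : IsTruncLimit φ c₀ c) :
    IsSolution φ c₀ ⊤ c := by
  obtain ⟨N, u, hNmono, hN2, hu, hlim⟩ := h
  have hN : Tendsto N atTop atTop := hNmono.tendsto_atTop
  set M := massNorm c₀
  have hnonneg : ∀ t, 0 ≤ t → ∀ i, 1 ≤ i → 0 ≤ c t i := fun t ht i hi =>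
    ge_of_tendsto (hlim i hi t ht) <| (hN.eventually_ge_atTop i).mono fun k hk =>
      (hu k).nonneg hφ hc₀ (hN2 k) hi hk ht
  have hsum : ∀ t, 0 ≤ t → ∀ m, ∑ i ∈ Finset.range m, (i : ℝ) * |c t i| ≤ M := by
    intro t ht m
    have h1 : ∑ i ∈ Finset.Icc 1 m, (i : ℝ) * c t i ≤ M := by
      refine le_of_tendsto (tendsto_finsetSum (Finset.Icc 1 m) fun i hi =>
        (hlim i (Finset.mem_Icc.1 hi).1 t ht).const_mul (i : ℝ)) ?_
      filter_upwards [hN.eventually_ge_atTop m] with k hk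
      refine le_trans (Finset.sum_le_sum_of_subset_of_nonneg (Finset.Icc_subset_Icc_right hk)
        fun j hj _ => ?_) ((hu k).sum_mul_le hφ hc₀ (hN2 k) ht)
      rw [Finset.mem_Icc] at hj
      exact mul_nonneg (Nat.cast_nonneg _) ((hu k).nonneg hφ hc₀ (hN2 k) hj.1 hj.2 ht)
    calc _ ≤ ∑ i ∈ Finset.range (m + 1), (i : ℝ) * |c t i| := by
          rw [Finset.sum_range_succ]
          exact le_add_of_nonneg_right (by positivity)
      _ = ∑ i ∈ Finset.Icc 1 m, (i : ℝ) * |c t i| := sum_range_succ_mul (fun i => |c t i|) m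
      _ = ∑ i ∈ Finset.Icc 1 m, (i : ℝ) * c t i := Finset.sum_congr rfl fun i hi => by
          rw [abs_of_nonneg (hnonneg t ht i (Finset.mem_Icc.1 hi).1)]
      _ ≤ M := h1
  have hmem : ∀ t, 0 ≤ t → MemBPlus (c t) := fun t ht =>
    ⟨summable_of_sum_range_le (fun i => by positivity) (hsum t ht), hnonneg t ht⟩
  have hbdd : ∀ t, 0 ≤ t → massNorm (c t) ≤ M := fun t ht =>
    Real.tsum_le_of_sum_range_le (fun i => by positivity) (hsum t ht)
  have hinit : ∀ i, 1 ≤ i → c 0 i = c₀ i := fun i hi =>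
    tendsto_nhds_unique (hlim i hi 0 le_rfl) <| tendsto_const_nhds.congr' <|
      (hN.eventually_ge_atTop i).mono fun k hk => ((hu k).initial i hi hk).symm
  have hrhs : ∀ i, 1 ≤ i → ∀ s, 0 ≤ s →
      Tendsto (fun k => truncRhs φ (N k) i (u k s)) atTop (𝓝 (rhs φ i (c s))) := by
    intro i hi s hs
    have hφi : Tendsto (φ i) atTop (𝓝 0) :=
      (hvanish i hi).congr' <| (eventually_ge_atTop 1).mono fun n hn => hφ.symm n i hn hi
    have hl := fun j hj => hlim j hj s hs
    have h1 := tendsto_sum_Icc_mul hφi hN (w := fun k => u k s) (M := M)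
      (fun k j h1 h2 => (hu k).nonneg hφ hc₀ (hN2 k) h1 h2 hs)
      (fun k => (hu k).sum_mul_le hφ hc₀ (hN2 k) hs) (hmem s hs) (hbdd s hs) hl hi
      ((hmem s hs).summable_kernel hφ hc hi le_rfl)
    rw [rhs_eq_growthRate φ _ hi]
    refine (((tendsto_growthRate φ hl (i - 1)).sub (tendsto_growthRate φ hl i)).sub
      ((hl i hi).mul h1)).congr' ?_
    filter_upwards [hN.eventually_gt_atTop i] with k hk
    rw [truncRhs_of_lt φ _ hi hk]
  refine ⟨fun t ht => hmem t ht.1, hinit, fun i hi => ?_, ⟨M, fun t ht => hbdd t ht.1⟩,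
    fun i hi t ht => ?_, fun i hi t ht => ?_⟩
  · refine (LipschitzOnWith.of_dist_le_mul (K := (8 * M ^ 2).toNNReal)
      fun s hs t ht => ?_).continuousOn
    rw [Real.coe_toNNReal _ (by positivity)]
    refine le_of_tendsto ((hlim i hi s hs.1).dist (hlim i hi t ht.1)) ?_
    filter_upwards [hN.eventually_gt_atTop i] with k hk
    rw [dist_eq_norm, dist_eq_norm]
    exact (convex_Ici (0 : ℝ)).norm_image_sub_le_of_norm_hasDerivWithin_le
      (fun x hx => (hu k).deriv i hi hk.le x hx)
      (fun x hx => (hu k).abs_truncRhs_le hφ hc hc₀ (hN2 k) hi hk hx) ht.1 hs.1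
  · have hb : ∀ s ∈ Ioc 0 t, ∑' k : ℕ, ENNReal.ofReal (φ i (k + 1) * c s (k + 1))
        ≤ ENNReal.ofReal (4 * i * M) := by
      intro s hs
      have hz := hmem s hs.1.le
      have hle : ∀ k : ℕ, φ i (k + 1) * c s (k + 1)
          ≤ 4 * i * (((1 + k : ℕ) : ℝ) * c s (1 + k)) := by
        intro k
        rw [add_comm k 1]
        have h1 := hc.linear_growth hi (j := 1 + k) (by omega)
        have h2 : (1 : ℝ) ≤ i := by exact_mod_cast hi
        have h3 : (1 : ℝ) ≤ ((1 + k : ℕ) : ℝ) := by exact_mod_cast (by omega : 1 ≤ 1 + k)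
        have h4 : φ i (1 + k) ≤ 4 * i * ((1 + k : ℕ) : ℝ) := by nlinarith
        rw [← mul_assoc]
        exact mul_le_mul_of_nonneg_right h4 (hz.nonneg _ (by omega))
      have h0 : ∀ k : ℕ, 0 ≤ φ i (k + 1) * c s (k + 1) := fun k =>
        mul_nonneg (hφ.nonneg _ _ hi (by omega)) (hz.nonneg _ (by omega))
      have hS := (hz.summable_shift 1).mul_left (4 * (i : ℝ))
      have hS' := Summable.of_nonneg_of_le h0 hle hS
      rw [← ENNReal.ofReal_tsum_of_nonneg h0 hS']
      refine ENNReal.ofReal_le_ofReal ((hS'.tsum_le_tsum hle hS).trans ?_)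
      rw [tsum_mul_left]
      exact mul_le_mul_of_nonneg_left (hz.tsum_shift_le (hbdd s hs.1.le) 1) (by positivity)
    refine (setLIntegral_mono measurable_const hb).trans_lt ?_
    rw [setLIntegral_const]
    exact ENNReal.mul_lt_top ENNReal.ofReal_lt_top measure_Ioc_lt_top
  · rw [hinit i hi]
    -- Dropping the finitely many truncations with `N k ≤ i` makes the integrands continuous.
    obtain ⟨K, hK⟩ := eventually_atTop.1 (hN.eventually_gt_atTop i)
    refine tendsto_nhds_unique (hlim i hi t ht.1) ?_
    have hint : Tendsto (fun k => ∫ s in (0 : ℝ)..t, truncRhs φ (N k) i (u k s)) atTop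
        (𝓝 (∫ s in (0 : ℝ)..t, rhs φ i (c s))) := by
      refine intervalIntegral.tendsto_integral_filter_of_dominated_convergence
        (fun _ => 8 * M ^ 2) ?_ ?_ intervalIntegrable_const ?_
      · filter_upwards [eventually_ge_atTop K] with k hk
        refine (((hu k).continuousOn_truncRhs hi (hK k hk)).mono
          fun s hs => ?_).aestronglyMeasurable measurableSet_uIoc
        rw [uIoc_of_le ht.1] at hs
        exact hs.1.le
      · filter_upwards [eventually_ge_atTop K] with k hk
        refine Eventually.of_forall fun s hs => ?_
        rw [uIoc_of_le ht.1] at hs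
        exact (hu k).abs_truncRhs_le hφ hc hc₀ (hN2 k) hi (hK k hk) hs.1.le
      · refine Eventually.of_forall fun s hs => ?_
        rw [uIoc_of_le ht.1] at hs
        exact hrhs i hi s hs.1.le
    refine (hint.const_add (c₀ i)).congr' ?_
    filter_upwards [eventually_ge_atTop K] with k hk
    exact ((hu k).integral_eq hi (hK k hk) ht.1).symm

end SafronovDubovski

theorem theorem4p1 (φ : ℕ → ℕ → ℝ) (hφ : SafronovDubovski.IsKernel φ)
    (hclass : SafronovDubovski.KernelClass φ)
    (hprod : ∀ i j : ℕ, 1 ≤ i → 1 ≤ j → φ i j ≤ (i : ℝ) * (j : ℝ))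
    (hvanish : ∀ j : ℕ, 1 ≤ j → Tendsto (fun n : ℕ => φ n j) atTop (𝓝 0))
    (c₀ : ℕ → ℝ) (hc₀ : SafronovDubovski.MemBPlus c₀) :
    (∀ (T : EReal) (c : ℝ → ℕ → ℝ), 0 < T → SafronovDubovski.IsSolution φ c₀ T c →
      ∀ t ∈ SafronovDubovski.timeInterval T,
        HasSum (fun i : ℕ => (i : ℝ) * c t i) (∑' i : ℕ, (i : ℝ) * c 0 i)) ∧
    (∀ c : ℝ → ℕ → ℝ, SafronovDubovski.IsTruncLimit φ c₀ c →
      ∀ t : ℝ, 0 ≤ t →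
        HasSum (fun i : ℕ => (i : ℝ) * c t i) (∑' i : ℕ, (i : ℝ) * c 0 i)) := by
  refine ⟨fun T c _ hc t ht => hc.hasSum_mass hφ hclass ht, fun c hc t ht => ?_⟩
  exact (hc.isSolution hφ hclass hvanish hc₀).hasSum_mass hφ hclass ⟨ht, EReal.coe_lt_top t⟩
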